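/- Let $\mathbb{N}=\{1,2,3,\dots\}$. For a ring $S$ with unity and $m\in\mathbb{N}$, an $m$-torsion clean decomposition of $r\in S$ is an expression $r=e+u$ with $e\in S$ idempotent ($e^2=e$) and $u\in S$ a unit satisfying $u^m=1$. The ring $S$ is called $m$-torsion clean if every element of $S$ has an $m$-torsion clean decomposition and $m$ is the least positive integer with this property. Let $q>1$ be an odd integer, and let $R$ be an integral domain (a nonzero commutative ring without zero divisors) of characteristic different from $2$ that is not isomorphic to $\mathbb{F}_3$. Then the following three conditions are equivalent: 1. for every $n\in\mathbb{N}$, the matrix ring $\mathbb{M}_n(R)$ is $(q-1)$-torsion clean; 2. for some $n\in\mathbb{N}$, the matrix ring $\mathbb{M}_n(R)$ is $(q-1)$-torsion clean; 3. $R$ is a finite field and $|R|=q$. -/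

import Mathlib

/-- `r` has an `m`-torsion clean decomposition: `r = e + u` with `e` idempotent and `u` a unit
with `u ^ m = 1`. -/
def HasTorsionCleanDecomposition {S : Type*} [Ring S] (m : ℕ) (r : S) : Prop :=
  ∃ (e : S) (u : Sˣ), IsIdempotentElem e ∧ u ^ m = 1 ∧ r = e + (u : S)

/-- The ring `S` is `m`-torsion clean: `m` is the least positive integer such that every element
of `S` has an `m`-torsion clean decomposition. -/
def IsTorsionClean (m : ℕ) (S : Type*) [Ring S] : Prop :=
  IsLeast {k : ℕ | 0 < k ∧ ∀ r : S, HasTorsionCleanDecomposition k r} m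

open Polynomial

namespace HasTorsionCleanDecomposition

/-! Necessity comes from scalar matrices: a decomposition of `r • 1` with exponent `k` forces `r ^ k
= 1` or `(r - 1) ^ k = 1`. Hence `R` is finite, so a field, and two translates of the group of
`k`-th roots of unity cover it; counting gives `|R| - 1 ∣ k`.

Conversely, over a finite field with `|F| ≥ 4` and `2 ≠ 0`, an endomorphism makes the space a direct
sum of cyclic `F[X]`-modules, and decompositions can be found summand by summand. In a cyclic
summand a suitable basis gives a Hessenberg form whose diagonal is arbitrary up to its trace. The
diagonal is chosen as `u j + d j` so that an idempotent with diagonal `d` can be subtracted, leaving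
a diagonalizable map with nonzero eigenvalues `u j`; its power `|F| - 1` is the identity. -/

theorem of_pow_eq_one {S : Type*} [Ring S] {m : ℕ} (hm : m ≠ 0) {r e u : S}
    (he : IsIdempotentElem e) (hu : u ^ m = 1) (hr : r = e + u) :
    HasTorsionCleanDecomposition m r :=
  ⟨e, Units.ofPowEqOne u m hu hm, he, by ext; simp, by simpa using hr⟩

theorem map {S T : Type*} [Ring S] [Ring T] (f : S →+* T) {m : ℕ} {r : S}
    (h : HasTorsionCleanDecomposition m r) : HasTorsionCleanDecomposition m (f r) := by
  obtain ⟨e, u, he, hu, rfl⟩ := h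
  refine ⟨f e, Units.map f.toMonoidHom u, he.map f, ?_, by simp⟩
  rw [← map_pow, hu, map_one]

theorem pi {ι : Type*} {S : ι → Type*} [∀ i, Ring (S i)] {m : ℕ} (hm : m ≠ 0) {r : ∀ i, S i}
    (h : ∀ i, HasTorsionCleanDecomposition m (r i)) : HasTorsionCleanDecomposition m r := by
  choose e u he hu hr using h
  refine of_pow_eq_one hm (e := e) (u := fun i => (u i : S i)) (funext fun i => he i)
    (funext fun i => ?_) (funext fun i => hr i)
  simpa using congrArg Units.val (hu i)

end HasTorsionCleanDecomposition

/-- The diagonal embedding of a product of endomorphism rings. -/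
def piEndRingHom (F : Type*) [CommSemiring F] {ι : Type*} (M : ι → Type*)
    [∀ i, AddCommMonoid (M i)] [∀ i, Module F (M i)] :
    (∀ i, Module.End F (M i)) →+* Module.End F (∀ i, M i) where
  toFun f := LinearMap.pi fun i => f i ∘ₗ LinearMap.proj i
  map_one' := by ext; rfl
  map_mul' _ _ := by ext; rfl
  map_zero' := by ext; rfl
  map_add' _ _ := by ext; rfl

/-! ### Scalar matrices -/

/-- The unit is `r • 1 - e`, which acts on the image of `e` as the scalar `r - 1`; if `e = 0` it is
`r • 1` itself. -/
theorem HasTorsionCleanDecomposition.pow_eq_one_or_of_scalar {R : Type*} [CommRing R] [IsDomain R]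
    {n k : ℕ} (hn : 0 < n) {r : R}
    (h : HasTorsionCleanDecomposition k (r • (1 : Matrix (Fin n) (Fin n) R))) :
    r ^ k = 1 ∨ (r - 1) ^ k = 1 := by
  obtain ⟨e, u, he, hu, hr⟩ := h
  have hu' : (u : Matrix (Fin n) (Fin n) R) ^ k = 1 := by
    simpa using congrArg Units.val hu
  have hur : (u : Matrix (Fin n) (Fin n) R) = r • 1 - e := by rw [hr]; simp
  by_cases h0 : e = 0
  · left
    rw [hur, h0, sub_zero, _root_.smul_pow, one_pow] at hu'
    simpa using congrFun (congrFun hu' ⟨0, hn⟩) ⟨0, hn⟩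
  · right
    have key : ∀ l : ℕ, (u : Matrix (Fin n) (Fin n) R) ^ l * e = (r - 1) ^ l • e := by
      intro l
      induction l with
      | zero => simp
      | succ l ih =>
        have : (u : Matrix (Fin n) (Fin n) R) * e = (r - 1) • e := by
          rw [hur, sub_mul, he.eq, smul_mul_assoc, one_mul, sub_smul, one_smul]
        rw [pow_succ, mul_assoc, this, mul_smul_comm, ih, smul_smul, pow_succ']
    have h1 := key k
    rw [hu', one_mul] at h1
    obtain ⟨i, j, hij⟩ : ∃ i j, e i j ≠ 0 := by
      by_contra! hc
      exact h0 (Matrix.ext hc)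
    have h2 : e i j = (r - 1) ^ k * e i j := congrFun (congrFun h1 i) j
    exact mul_right_cancel₀ hij (by rw [← h2, one_mul])

theorem finite_of_forall_pow_eq_one_or {R : Type*} [CommRing R] [IsDomain R] {k : ℕ} (hk : 0 < k)
    (h : ∀ r : R, r ^ k = 1 ∨ (r - 1) ^ k = 1) : Finite R := by
  by_contra hinf
  rw [not_finite_iff_infinite] at hinf
  have hX : (X ^ k - 1 : R[X]) ≠ 0 := (monic_X_pow_sub_C 1 hk.ne').ne_zero
  have hX1 : ((X - 1) ^ k - 1 : R[X]) ≠ 0 := by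
    intro h0
    apply hX
    have h1 := congrArg (fun p : R[X] => p.comp (X + 1)) h0
    simp only [sub_comp, pow_comp, X_comp, one_comp, zero_comp, add_sub_cancel_right] at h1
    exact h1
  refine mul_ne_zero hX hX1 (eq_zero_of_infinite_isRoot _ ?_)
  convert Set.infinite_univ (α := R)
  ext r
  simpa [sub_eq_zero] using h r

theorem card_sub_one_dvd_of_forall_pow_eq_one_or {F : Type*} [Field F] [Finite F] {k : ℕ}
    (h : ∀ r : F, r ^ k = 1 ∨ (r - 1) ^ k = 1) : Nat.card F - 1 ∣ k := by
  classical
  have := Fintype.ofFinite F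
  rw [Nat.card_eq_fintype_card, ← FiniteField.forall_pow_eq_one_iff]
  rcases Nat.eq_zero_or_pos k with rfl | hk
  · simp
  let H : Subgroup Fˣ := (powMonoidHom k : Fˣ →* Fˣ).ker
  have hH : ∀ x : Fˣ, x ∈ H ↔ x ^ k = 1 := fun x => by simp [H, MonoidHom.mem_ker]
  have hlift : ∀ r : F, r ^ k = 1 → ∃ x : H, ((x : Fˣ) : F) = r := fun r hr =>
    ⟨⟨Units.ofPowEqOne r k hr hk.ne', (hH _).2 (by ext; simp)⟩, rfl⟩
  have hsurj : Function.Surjective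
      (fun x : H ⊕ H => Sum.elim (fun y : H => ((y : Fˣ) : F)) (fun y : H => ((y : Fˣ) : F) + 1) x) := by
    intro r
    rcases h r with h | h
    · obtain ⟨x, hx⟩ := hlift r h
      exact ⟨Sum.inl x, hx⟩
    · obtain ⟨x, hx⟩ := hlift _ h
      exact ⟨Sum.inr x, by simp [hx]⟩
  have hle := Nat.card_le_card_of_surjective _ hsurj
  rw [Nat.card_sum] at hle
  have hidx := H.card_mul_index
  rw [Nat.card_units] at hidx
  have hpos : 0 < Nat.card F := Nat.card_pos
  -- `F` is covered by `H` and `H + 1`, so `|F| ≤ 2|H|`; index at least 2 would give `2|H| ≤ |F| -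
  -- 1`.
  have hi : H.index = 1 := by
    have hi0 : H.index ≠ 0 := Subgroup.index_ne_zero_of_finite
    by_contra hi1
    have : 2 ≤ H.index := by omega
    nlinarith [Nat.mul_le_mul_left (Nat.card H) this, Nat.sub_add_cancel hpos]
  intro x
  rw [← hH, Subgroup.index_eq_one.1 hi]
  trivial

/-! ### The choice of the eigenvalues -/

theorem exists_eigenvalue_sequence {F : Type*} [Field F] [Finite F] (h2 : (2 : F) ≠ 0)
    (hcard : 4 ≤ Nat.card F) {n : ℕ} (hn : 0 < n) (t : F) :
    ∃ u d : ℕ → F, ∑ j ∈ Finset.range n, (u j + d j) = t ∧ (∀ j, d j * d j = d j) ∧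
      (∀ j, Odd j → j < n → d j = 0 ∧ d (j - 1) = 1) ∧ (∀ j < n, u j ≠ 0) ∧
      (∀ j < n, 0 < j → u j ≠ u 0) ∧ (∀ j, Odd j → j + 1 < n → u (j + 1) ≠ u j) := by
  classical
  have := Fintype.ofFinite F
  rw [Nat.card_eq_fintype_card] at hcard
  have avoid : ∀ a b c : F, ∃ x, x ≠ a ∧ x ≠ b ∧ x ≠ c := by
    intro a b c
    obtain ⟨x, hx⟩ : ∃ x, x ∉ ({a, b, c} : Finset F) := by
      by_contra! hc
      have := Finset.card_le_card (fun x _ => hc x : Finset.univ ⊆ ({a, b, c} : Finset F))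
      have := Finset.card_le_three (a := a) (b := b) (c := c)
      rw [Finset.card_univ] at *
      omega
    exact ⟨x, by simpa using hx⟩
  have base : ∀ (c x : F) (m : ℕ), ∑ j ∈ Finset.range (2 * m),
      ((if j = 0 then c else if Even j then -x else x) + if Even j then 1 else 0) =
        if m = 0 then 0 else c + x + m := by
    intro c x m
    induction m with
    | zero => simp
    | succ m ih =>
      rw [show 2 * (m + 1) = 2 * m + 1 + 1 by ring, Finset.sum_range_succ, Finset.sum_range_succ, ih]
      rcases Nat.eq_zero_or_pos m with rfl | hm
      · simp; ring
      · simp [hm.ne', parity_simps]; ring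
  have hneg : ∀ x : F, x ≠ 0 → -x ≠ x := by
    intro x hx h
    apply mul_ne_zero h2 hx
    linear_combination -h
  rcases Nat.even_or_odd' n with ⟨m, rfl | rfl⟩
  · obtain ⟨m, rfl⟩ : ∃ l, m = l + 1 := ⟨m - 1, by omega⟩
    -- The sequence `u` is `c, x, -x, …, x, -x, y`, with `y` fixing the sum. The excluded values of
    -- `c` ensure `c ≠ 0`, `y ≠ 0` and `y ≠ c`.
    obtain ⟨c, hc0, hcs, hc2⟩ := avoid 0 (t - (m + 1)) ((t - (m + 1)) / 2)
    obtain ⟨x, hx0, hxc, hxc'⟩ := avoid 0 c (-c)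
    have hx' : -x ≠ c := fun h => hxc' (by rw [← h, neg_neg])
    obtain ⟨y, hy⟩ : ∃ y, y = t - (m + 1) - c := ⟨_, rfl⟩
    have hy0 : y ≠ 0 := by rw [hy]; exact sub_ne_zero.2 hcs.symm
    have hyc : y ≠ c := by
      intro h
      apply hc2
      field_simp
      linear_combination -h + hy
    refine ⟨fun j => if j = 2 * m + 1 then y else if j = 0 then c else if Even j then -x else x,
      fun j => if Even j then 1 else 0, ?_, ?_, ?_, ?_, ?_, ?_⟩
    · have hb := base c x (m + 1)
      rw [show 2 * (m + 1) = 2 * m + 1 + 1 by ring, Finset.sum_range_succ] at hb ⊢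
      rw [Finset.sum_congr rfl (g := fun j => (if j = 0 then c else if Even j then -x else x) +
        if Even j then 1 else 0)]
      · simp [parity_simps] at hb ⊢
        linear_combination hb + hy
      · intro j hj
        simp only [if_neg (Finset.mem_range.1 hj).ne]
    · intro j; dsimp only; split_ifs <;> simp
    · intro j hj hjn
      have := Nat.Odd.sub_odd hj odd_one
      simp [Nat.not_even_iff_odd.2 hj, this]
    · intro j hj; dsimp only; split_ifs <;> first | assumption | exact neg_ne_zero.2 ‹_›
    · intro j hj hj0
      dsimp only
      rw [if_neg hj0.ne', if_neg (by omega : ¬ 0 = 2 * m + 1), if_pos rfl]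
      split_ifs <;> assumption
    · intro j hj hjn
      dsimp only
      have h1 : ¬ j = 2 * m + 1 := by omega
      have h3 : ¬ j = 0 := by rintro rfl; simp at hj
      have h4 : ¬ j + 1 = 2 * m + 1 := by
        rcases hj with ⟨l, rfl⟩; omega
      simp only [h1, h3, h4, hj.add_one, Nat.not_even_iff_odd.2 hj, if_true, if_false]
      simpa using hneg x hx0
  -- The last index is even, so its `d` is free: taking it to be 0 or 1 keeps `c` nonzero, and the
  -- pairs `x, -x` cancel.
  · obtain ⟨δ, hδ, hs⟩ : ∃ δ : F, δ * δ = δ ∧ t - m - δ ≠ 0 := by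
      by_cases h : t - m - 0 = 0
      · exact ⟨1, by simp, fun h' => one_ne_zero (by linear_combination h - h')⟩
      · exact ⟨0, by simp, h⟩
    obtain ⟨c, hc⟩ : ∃ c, c = t - m - δ := ⟨_, rfl⟩
    rw [← hc] at hs
    obtain ⟨x, hx0, hxc, hxc'⟩ := avoid 0 c (-c)
    have hx' : -x ≠ c := fun h => hxc' (by rw [← h, neg_neg])
    refine ⟨fun j => if j = 0 then c else if Even j then -x else x,
      fun j => if j = 2 * m then δ else if Even j then 1 else 0, ?_, ?_, ?_, ?_, ?_, ?_⟩
    · rw [Finset.sum_range_succ, Finset.sum_congr rfl (g := fun j =>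
        (if j = 0 then c else if Even j then -x else x) + if Even j then 1 else 0), base]
      · rcases Nat.eq_zero_or_pos m with rfl | hm
        · simp [hc]
        · simp [hm.ne', hc]; ring
      · intro j hj
        simp only [if_neg (Finset.mem_range.1 hj).ne]
    · intro j; dsimp only; split_ifs <;> first | exact hδ | exact mul_one _ | exact mul_zero _
    · intro j hj hjn
      have h1 : ¬ j = 2 * m := by rintro rfl; exact Nat.not_even_iff_odd.2 hj (even_two_mul m)
      have h2 : ¬ j - 1 = 2 * m := by have := hj.pos; omega
      have := Nat.Odd.sub_odd hj odd_one
      simp [h1, h2, Nat.not_even_iff_odd.2 hj, this]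
    · intro j hj; dsimp only; split_ifs <;> first | assumption | exact neg_ne_zero.2 ‹_›
    · intro j hj hj0
      dsimp only
      rw [if_neg hj0.ne', if_pos rfl]
      split_ifs <;> assumption
    · intro j hj hjn
      have h3 : ¬ j = 0 := by rintro rfl; simp at hj
      simp [h3, hj.add_one, Nat.not_even_iff_odd.2 hj, hneg x hx0]

/-! ### Endomorphisms in Hessenberg form -/

theorem pow_apply_eq_self_of_apply_eq_smul {F V : Type*} [Field F] [AddCommGroup V] [Module F V]
    {m : ℕ} {U : Module.End F V} {w : V} {μ : F} (hμ : μ ^ m = 1) (h : U w = μ • w) :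
    (U ^ m) w = w := by
  have : ∀ l : ℕ, (U ^ l) w = μ ^ l • w := by
    intro l
    induction l with
    | zero => simp
    | succ l ih => rw [pow_succ', Module.End.mul_apply, ih, map_smul, h, smul_smul, pow_succ]
  rw [this, hμ, one_smul]

/-- The idempotent absorbs every other superdiagonal entry, so on the span of the `v j` with `j > 0`
the rest splits into blocks of size at most 2 with distinct eigenvalues. As `u 0` is not among
these, `v 0` can be corrected to an eigenvector. -/
theorem hasTorsionCleanDecomposition_of_hessenberg {F V : Type*} [Field F] [AddCommGroup V]
    [Module F V] {m : ℕ} (hm : m ≠ 0) (hpow : ∀ x : F, x ≠ 0 → x ^ m = 1) {n : ℕ}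
    (b : Module.Basis (Fin n) F V) {v : ℕ → V} (hb : ∀ i : Fin n, b i = v i) (T : Module.End F V)
    {u d : ℕ → F} (hd : ∀ j, d j * d j = d j) (hdodd : ∀ j, Odd j → j < n → d j = 0 ∧ d (j - 1) = 1)
    (hu : ∀ j < n, u j ≠ 0) (hu0 : ∀ j < n, 0 < j → u j ≠ u 0)
    (husucc : ∀ j, Odd j → j + 1 < n → u (j + 1) ≠ u j)
    (hT : ∀ j < n, 0 < j → T (v j) = v (j - 1) + (u j + d j) • v j)
    (hT0 : T (v 0) - (u 0 + d 0) • v 0 ∈ Submodule.span F (v '' {j | 0 < j ∧ j < n})) :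
    HasTorsionCleanDecomposition m T := by
  let E : Module.End F V := b.constr F fun i : Fin n => if Even (i : ℕ) then d i • v i else v (i - 1)
  have hE : ∀ j < n, E (v j) = if Even j then d j • v j else v (j - 1) := by
    intro j hj
    have := b.constr_basis F
      (fun i : Fin n => if Even (i : ℕ) then d i • v i else v (i - 1)) ⟨j, hj⟩
    rwa [hb] at this
  obtain ⟨U, hU⟩ : ∃ U, U = T - E := ⟨_, rfl⟩
  have hUodd : ∀ j < n, Odd j → U (v j) = u j • v j := by
    intro j hj hjo
    rw [hU, LinearMap.sub_apply, hE j hj, if_neg (Nat.not_even_iff_odd.2 hjo), hT j hj hjo.pos,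
      (hdodd j hjo hj).1]
    simp
  have hUeven : ∀ j, Odd j → j + 1 < n → U (v (j + 1)) = v j + u (j + 1) • v (j + 1) := by
    intro j hjo hj
    rw [hU, LinearMap.sub_apply, hE _ hj, if_pos hjo.add_one, hT _ hj j.succ_pos]
    simp only [Nat.add_sub_cancel]
    module
  -- vectors fixed by `U ^ m`
  let K : Submodule F V := LinearMap.eqLocus (U ^ m) 1
  have hK : ∀ {w : V} {μ : F}, μ ≠ 0 → U w = μ • w → w ∈ K := fun hμ h =>
    pow_apply_eq_self_of_apply_eq_smul (hpow _ hμ) h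
  have hKodd : ∀ j < n, Odd j → v j ∈ K := fun j hj hjo => hK (hu j hj) (hUodd j hj hjo)
  have hKeven : ∀ j, Odd j → j + 1 < n → v (j + 1) ∈ K := by
    intro j hjo hj
    have hne : u (j + 1) - u j ≠ 0 := sub_ne_zero.2 (husucc j hjo hj)
    -- The eigenvector for `u (j + 1)` in the block spanned by `v j` and `v (j + 1)`.
    have h1 : v (j + 1) + (u (j + 1) - u j)⁻¹ • v j ∈ K := by
      refine hK (hu _ hj) ?_
      rw [map_add, map_smul, hUeven j hjo hj, hUodd j (by omega) hjo]
      match_scalars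
      · field_simp; ring
      · ring
    simpa using K.sub_mem h1 (K.smul_mem (u (j + 1) - u j)⁻¹ (hKodd j (by omega) hjo))
  have hKpos : ∀ j < n, 0 < j → v j ∈ K := by
    intro j hj hj0
    rcases Nat.even_or_odd j with h | h
    · obtain ⟨i, rfl⟩ : ∃ i, j = i + 1 := ⟨j - 1, by omega⟩
      exact hKeven i (by simpa [parity_simps] using h) hj
    · exact hKodd j hj h
  let W : Submodule F V := Submodule.span F (v '' {j | 0 < j ∧ j < n})
  have hvW : ∀ j < n, 0 < j → v j ∈ W := fun j hj hj0 => Submodule.subset_span ⟨j, ⟨hj0, hj⟩, rfl⟩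
  have hWK : W ≤ K := by
    rw [Submodule.span_le]
    rintro _ ⟨j, ⟨hj0, hj⟩, rfl⟩
    exact hKpos j hj hj0
  -- `U - u 0` is onto on `W`
  have hWmap : W ≤ W.map (U - algebraMap F _ (u 0)) := by
    have hodd : ∀ j < n, Odd j → v j ∈ W.map (U - algebraMap F _ (u 0)) := by
      intro j hj hjo
      have hne : u j - u 0 ≠ 0 := sub_ne_zero.2 (hu0 j hj hjo.pos)
      refine ⟨(u j - u 0)⁻¹ • v j, W.smul_mem _ (hvW j hj hjo.pos), ?_⟩
      rw [LinearMap.sub_apply, map_smul, hUodd j hj hjo, Module.algebraMap_end_apply]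
      match_scalars
      field_simp
    rw [Submodule.span_le]
    rintro _ ⟨j, ⟨hj0, hj⟩, rfl⟩
    rcases Nat.even_or_odd j with h | h
    · obtain ⟨i, rfl⟩ : ∃ i, j = i + 1 := ⟨j - 1, by omega⟩
      have hio : Odd i := by simpa [parity_simps] using h
      have hne : u (i + 1) - u 0 ≠ 0 := sub_ne_zero.2 (hu0 _ hj hj0)
      have h1 : (u (i + 1) - u 0) • v (i + 1) + v i ∈ W.map (U - algebraMap F _ (u 0)) := by
        refine ⟨v (i + 1), hvW _ hj hj0, ?_⟩
        rw [LinearMap.sub_apply, hUeven i hio hj, Module.algebraMap_end_apply]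
        module
      have h2 := Submodule.sub_mem _ h1 (hodd i (by omega) hio)
      rw [add_sub_cancel_right] at h2
      exact (Submodule.smul_mem_iff _ hne).1 h2
    · exact hodd j hj h
  have hKzero : 0 < n → v 0 ∈ K := by
    intro hn
    -- Solving `(U - u 0) w = (U - u 0) v 0` inside `W` makes `v 0 - w` an eigenvector for `u 0`.
    obtain ⟨w, hw, hw'⟩ := hWmap hT0
    rw [LinearMap.sub_apply, Module.algebraMap_end_apply] at hw'
    have h1 : v 0 - w ∈ K := by
      refine hK (hu 0 hn) ?_
      have h2 : U (v 0) = T (v 0) - d 0 • v 0 := by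
        rw [hU, LinearMap.sub_apply, hE 0 hn]
        simp
      rw [map_sub, h2]
      have h3 : U w = u 0 • w + (T (v 0) - (u 0 + d 0) • v 0) := by rw [← hw']; abel
      rw [h3]
      module
    simpa using K.add_mem h1 (hWK hw)
  refine HasTorsionCleanDecomposition.of_pow_eq_one hm (e := E) (u := U) ?_ ?_ (by rw [hU]; abel)
  · refine b.ext fun i => ?_
    rw [hb, Module.End.mul_apply, hE i i.2]
    split_ifs with h
    · rw [map_smul, hE i i.2, if_pos h, smul_smul, hd]
    · have ho := Nat.not_even_iff_odd.1 h
      rw [hE _ (by omega), if_pos (Nat.Odd.sub_odd ho odd_one), (hdodd i ho i.2).2, one_smul]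
  · refine b.ext fun i => ?_
    rw [hb]
    change v i ∈ K
    rcases Nat.eq_zero_or_pos (i : ℕ) with h | h
    · rw [h]; exact hKzero (by omega)
    · exact hKpos i i.2 h

/-! ### Cyclic modules over the polynomial ring -/

/-- The polynomial `∏ k ∈ (j, n), (X - a k)`. -/
noncomputable def tailProd {F : Type*} [Field F] (a : ℕ → F) (n j : ℕ) : F[X] :=
  ∏ k ∈ Finset.Ico (j + 1) n, (X - C (a k))

section tailProd

variable {F : Type*} [Field F] (a : ℕ → F) (n : ℕ)

theorem tailProd_monic (j : ℕ) : (tailProd a n j).Monic :=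
  monic_prod_of_monic _ _ fun _ _ => monic_X_sub_C _

theorem natDegree_tailProd (j : ℕ) : (tailProd a n j).natDegree = n - (j + 1) := by
  rw [tailProd, natDegree_prod_of_monic _ _ fun k _ => monic_X_sub_C (a k)]
  simp

theorem X_mul_tailProd {j : ℕ} (hj : j < n) (hj0 : 0 < j) :
    X * tailProd a n j = tailProd a n (j - 1) + C (a j) * tailProd a n j := by
  have : tailProd a n (j - 1) = (X - C (a j)) * tailProd a n j := by
    simp only [tailProd, Nat.sub_add_cancel hj0]
    exact Finset.prod_eq_prod_Ico_succ_bot hj _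
  rw [this]
  ring

theorem X_mul_tailProd_zero (hn : 0 < n) :
    X * tailProd a n 0 - C (a 0) * tailProd a n 0 = ∏ k ∈ Finset.range n, (X - C (a k)) := by
  rw [Finset.range_eq_Ico, Finset.prod_eq_prod_Ico_succ_bot hn]
  simp only [tailProd]
  ring

/-- The tail products are monic of degrees `0, …, n - 1`, so leading terms can be eliminated one by
one. -/
theorem mem_span_tailProd (l : ℕ) : l ≤ n → ∀ f : F[X], f.degree < l →
    f ∈ Submodule.span F (tailProd a n '' {j | n - l ≤ j ∧ j < n}) := by
  induction l with
  | zero =>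
    intro _ f hf
    rw [degree_lt_iff_coeff_zero] at hf
    rw [show f = 0 from ext fun k => hf k k.zero_le]
    exact Submodule.zero_mem _
  | succ l ih =>
    intro hl f hf
    have h1 : f - C (f.coeff l) * tailProd a n (n - (l + 1)) ∈
        Submodule.span F (tailProd a n '' {j | n - (l + 1) ≤ j ∧ j < n}) := by
      refine Submodule.span_mono (Set.image_mono ?_) (ih (by omega) _ ?_)
      · rintro j ⟨h, h'⟩
        exact ⟨by omega, h'⟩
      · rw [degree_lt_iff_coeff_zero] at hf ⊢
        intro k hk
        have hdeg : (tailProd a n (n - (l + 1))).natDegree = l := by rw [natDegree_tailProd]; omega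
        rcases hk.eq_or_lt with rfl | hk
        · have := (tailProd_monic a n (n - (l + 1))).coeff_natDegree
          rw [hdeg] at this
          simp [this]
        · rw [coeff_sub, coeff_C_mul, hf k hk, coeff_eq_zero_of_natDegree_lt (hdeg.trans_lt hk)]
          simp
    have h2 : tailProd a n (n - (l + 1)) ∈ Submodule.span F (tailProd a n '' {j | n - (l + 1) ≤ j ∧ j < n}) :=
      Submodule.subset_span ⟨_, ⟨le_rfl, by omega⟩, rfl⟩
    have := Submodule.add_mem _ h1 (Submodule.smul_mem _ (f.coeff l) h2)
    rwa [smul_eq_C_mul, sub_add_cancel] at this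

theorem degree_prod_X_sub_C_sub_lt {g : F[X]} (hg : g.Monic) (hn : n = g.natDegree) (hpos : 0 < n)
    (hsum : ∑ k ∈ Finset.range n, a k = -g.nextCoeff) :
    (∏ k ∈ Finset.range n, (X - C (a k)) - g).degree < (n - 1 : ℕ) := by
  obtain ⟨Q, hQ⟩ : ∃ Q, Q = ∏ k ∈ Finset.range n, (X - C (a k)) := ⟨_, rfl⟩
  have hQmonic : Q.Monic := hQ ▸ monic_prod_of_monic _ _ fun k _ => monic_X_sub_C _
  have hQdeg : Q.natDegree = n := by
    rw [hQ, natDegree_prod_of_monic _ _ fun k _ => monic_X_sub_C (a k)]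
    simp
  have hQnext : Q.nextCoeff = g.nextCoeff := by
    rw [hQ, Monic.nextCoeff_prod _ _ fun k _ => monic_X_sub_C _]
    simp only [nextCoeff_X_sub_C, Finset.sum_neg_distrib, hsum, neg_neg]
  rw [← hQ, degree_lt_iff_coeff_zero]
  intro k hk
  rw [coeff_sub, sub_eq_zero]
  rcases lt_trichotomy k n with h | h | h
  · obtain rfl : k = n - 1 := by omega
    rwa [nextCoeff_of_natDegree_pos (by omega), nextCoeff_of_natDegree_pos (by omega), hQdeg,
      ← hn] at hQnext
  · have h3 := hQmonic.coeff_natDegree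
    have h4 := hg.coeff_natDegree
    rw [hQdeg, ← h] at h3
    rw [← hn, ← h] at h4
    rw [h3, h4]
  · rw [coeff_eq_zero_of_natDegree_lt (by omega), coeff_eq_zero_of_natDegree_lt (by omega)]

end tailProd

theorem hasTorsionCleanDecomposition_of_cyclic {F M : Type*} [Field F] [Finite F]
    [AddCommGroup M] [Module F M] [Module.Finite F M] (h2 : (2 : F) ≠ 0) (hcard : 4 ≤ Nat.card F)
    {g : F[X]} (hg : g.Monic) (hrank : Module.finrank F M = g.natDegree) {π : F[X] →ₗ[F] M}
    (hπ : Function.Surjective π) (hπg : ∀ f, π (f * g) = 0) {T : Module.End F M}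
    (hπX : ∀ f, T (π f) = π (X * f)) : HasTorsionCleanDecomposition (Nat.card F - 1) T := by
  have hm : Nat.card F - 1 ≠ 0 := by omega
  have hpow : ∀ x : F, x ≠ 0 → x ^ (Nat.card F - 1) = 1 := by
    have := Fintype.ofFinite F
    rw [Nat.card_eq_fintype_card]
    exact FiniteField.pow_card_sub_one_eq_one
  obtain ⟨n, hn⟩ : ∃ n, n = g.natDegree := ⟨_, rfl⟩
  rcases Nat.eq_zero_or_pos n with h0 | hpos
  · rw [← hn, h0] at hrank
    have := Module.finrank_zero_iff.1 hrank
    exact HasTorsionCleanDecomposition.of_pow_eq_one hm (e := 0) (u := 1) (mul_zero _) (one_pow _)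
      (LinearMap.ext fun x => Subsingleton.elim _ _)
  obtain ⟨u, d, hsum, hd, hdodd, hu, hu0, husucc⟩ :=
    exists_eigenvalue_sequence h2 hcard hpos (-g.nextCoeff)
  let a : ℕ → F := fun k => u k + d k
  let P := tailProd a n
  let v : ℕ → M := fun j => π (P j)
  have htop : ⊤ ≤ Submodule.span F (Set.range fun i : Fin n => v i) := by
    intro y _
    obtain ⟨f, rfl⟩ := hπ y
    have h1 : π f = π (f %ₘ g) := by
      conv_lhs => rw [← modByMonic_add_div f g]
      rw [map_add, mul_comm, hπg, add_zero]
    have h2 := mem_span_tailProd a n n le_rfl (f %ₘ g) (by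
      rw [hn, ← degree_eq_natDegree hg.ne_zero]; exact degree_modByMonic_lt f hg)
    rw [h1]
    refine Submodule.span_mono ?_ (Submodule.apply_mem_span_image_of_mem_span π h2)
    rintro _ ⟨_, ⟨j, ⟨_, hj⟩, rfl⟩, rfl⟩
    exact ⟨⟨j, hj⟩, rfl⟩
  let b := basisOfTopLeSpanOfCardEqFinrank (fun i : Fin n => v i) htop (by simp [hrank, hn])
  refine hasTorsionCleanDecomposition_of_hessenberg hm hpow b (v := v)
    (fun i => by simp [b]) _ hd hdodd hu hu0 husucc ?_ ?_
  · intro j hj hj0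
    change T (π (P j)) = π _ + _ • π _
    rw [hπX, X_mul_tailProd a n hj hj0, map_add, ← smul_eq_C_mul, map_smul]
  · change T (π (P 0)) - _ • π (P 0) ∈ _
    have hQ := X_mul_tailProd_zero a n hpos
    obtain ⟨Q, hQdef⟩ : ∃ Q, Q = ∏ k ∈ Finset.range n, (X - C (a k)) := ⟨_, rfl⟩
    -- The prescribed trace matters here: `Q` and `g` share their top two coefficients, so `π Q = π
    -- (Q - g)` needs only the basis vectors of positive index.
    have hdeg : (Q - g).degree < (n - 1 : ℕ) :=
      hQdef ▸ degree_prod_X_sub_C_sub_lt a n hg hn hpos hsum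
    have h1 := Submodule.apply_mem_span_image_of_mem_span π (mem_span_tailProd a n (n - 1) (by omega) _ hdeg)
    have h2 : π (Q - g) = π Q := by
      have := hπg 1
      rw [one_mul] at this
      rw [map_sub, this, sub_zero]
    rw [h2, hQdef, ← hQ, map_sub, ← smul_eq_C_mul, map_smul] at h1
    rw [hπX]
    refine Submodule.span_mono ?_ h1
    rintro _ ⟨_, ⟨j, ⟨hj0, hj⟩, rfl⟩, rfl⟩
    exact ⟨j, ⟨by omega, hj⟩, rfl⟩

theorem hasTorsionCleanDecomposition_lsmul_X_of_cyclic {F M : Type*} [Field F] [Finite F]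
    [AddCommGroup M] [Module F M] [Module F[X] M] [IsScalarTower F F[X] M] [Module.Finite F M]
    (h2 : (2 : F) ≠ 0) (hcard : 4 ≤ Nat.card F) {g : F[X]} (hg' : g.Monic)
    (hrank : Module.finrank F M = g.natDegree)
    (π : F[X] →ₗ[F[X]] M) (hπ : Function.Surjective π) (hg : π g = 0) :
    HasTorsionCleanDecomposition (Nat.card F - 1)
      (Algebra.lsmul F F M (X : F[X])) := by
  refine hasTorsionCleanDecomposition_of_cyclic h2 hcard hg' hrank
    (π := π.restrictScalars F) hπ (fun f => ?_) (fun f => ?_)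
  · rw [LinearMap.restrictScalars_apply, ← smul_eq_mul, map_smul, hg, smul_zero]
  · exact (map_smul π X f).symm

theorem hasTorsionCleanDecomposition_lsmul_X_quotient {F : Type*} [Field F] [Finite F]
    (h2 : (2 : F) ≠ 0) (hcard : 4 ≤ Nat.card F) {g : F[X]} (hg : g ≠ 0) :
    HasTorsionCleanDecomposition (Nat.card F - 1)
      (Algebra.lsmul F F (F[X] ⧸ Ideal.span {g}) (X : F[X])) := by
  classical
  rw [← Ideal.span_singleton_eq_span_singleton.2 (normalize_associated g)]
  have hg' : (normalize g).Monic := monic_normalize hg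
  have := hg'.finite_quotient
  exact hasTorsionCleanDecomposition_lsmul_X_of_cyclic h2 hcard hg'
    (finrank_quotient_span_eq_natDegree' hg') (Submodule.mkQ (Ideal.span {normalize g}))
    (Submodule.mkQ_surjective _)
    ((Submodule.Quotient.mk_eq_zero _).2 (Ideal.mem_span_singleton_self (normalize g)))

/-! ### Matrices over finite fields -/

theorem hasTorsionCleanDecomposition_end {F V : Type*} [Field F] [Finite F] [AddCommGroup V]
    [Module F V] [FiniteDimensional F V] (h2 : (2 : F) ≠ 0) (hcard : 4 ≤ Nat.card F)
    (T : Module.End F V) : HasTorsionCleanDecomposition (Nat.card F - 1) T := by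
  classical
  have hm : Nat.card F - 1 ≠ 0 := by omega
  -- `V` with `X` acting as `T` is finitely generated torsion over a PID.
  have : Module.Finite F[X] (Module.AEval' T) := inferInstance
  obtain ⟨ι, _, p, hp, e, ⟨φ⟩⟩ := Module.equiv_directSum_of_isTorsion
    (Module.AEval.isTorsion_of_finiteDimensional F V T)
  let ψ := φ.trans (DirectSum.linearEquivFunOnFintype F[X] ι _)
  have hpi : HasTorsionCleanDecomposition (Nat.card F - 1)
      (fun i => Algebra.lsmul F F (F[X] ⧸ Ideal.span {p i ^ e i}) (X : F[X])) :=
    HasTorsionCleanDecomposition.pi hm fun i =>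
      hasTorsionCleanDecomposition_lsmul_X_quotient h2 hcard (pow_ne_zero _ (hp i).ne_zero)
  let χ : V ≃ₗ[F] (∀ i, F[X] ⧸ Ideal.span {p i ^ e i}) :=
    (Module.AEval'.of T).trans (ψ.restrictScalars F)
  let S := Module.End F (∀ i, F[X] ⧸ Ideal.span {p i ^ e i})
  convert HasTorsionCleanDecomposition.map (S := S) (T := Module.End F V)
    χ.symm.conjRingEquiv.toRingHom (HasTorsionCleanDecomposition.map (T := S) (piEndRingHom F _) hpi)
  ext x
  apply χ.injective
  have h1 : χ (T x) = (X : F[X]) • χ x := by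
    change ψ (Module.AEval'.of T (T x)) = (X : F[X]) • ψ (Module.AEval'.of T x)
    rw [← map_smul, Module.AEval'.X_smul_of]
  rw [h1]
  exact (χ.apply_symm_apply _).symm

theorem hasTorsionCleanDecomposition_matrix {F : Type*} [Field F] [Finite F] (h2 : (2 : F) ≠ 0)
    (hcard : 4 ≤ Nat.card F) {n : ℕ} (A : Matrix (Fin n) (Fin n) F) :
    HasTorsionCleanDecomposition (Nat.card F - 1) A := by
  have := (hasTorsionCleanDecomposition_end h2 hcard (Matrix.toLinAlgEquiv' A)).map
    (Matrix.toLinAlgEquiv' (R := F) (n := Fin n)).symm.toRingEquiv.toRingHom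
  simpa using this

theorem four_le_card_of_not_ringEquiv {F : Type*} [Field F] [Finite F] (h2 : (2 : F) ≠ 0)
    (h3 : IsEmpty (F ≃+* ZMod 3)) : 4 ≤ Nat.card F := by
  have := Fintype.ofFinite F
  rw [Nat.card_eq_fintype_card]
  by_contra! hlt
  have h1 : 1 < Fintype.card F := Fintype.one_lt_card
  obtain h | h : Fintype.card F = 2 ∨ Fintype.card F = 3 := by omega
  · apply h2
    have := Nat.cast_card_eq_zero F
    rw [h] at this
    exact_mod_cast this
  · exact h3.false (ZMod.ringEquivOfPrime F Nat.prime_three h).symm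

/-! ### Minimality of the exponent and the equivalence -/

theorem isTorsionClean_matrix {F : Type*} [Field F] [Finite F] (h2 : (2 : F) ≠ 0)
    (hcard : 4 ≤ Nat.card F) {n : ℕ} (hn : 0 < n) :
    IsTorsionClean (Nat.card F - 1) (Matrix (Fin n) (Fin n) F) :=
  ⟨⟨by omega, hasTorsionCleanDecomposition_matrix h2 hcard⟩, fun _ hk =>
    Nat.le_of_dvd hk.1 (card_sub_one_dvd_of_forall_pow_eq_one_or fun r =>
      (hk.2 (r • 1)).pow_eq_one_or_of_scalar hn)⟩

theorem isTorsionClean_matrix_of_isField {R : Type*} [CommRing R] (hR : IsField R) [Finite R]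
    (h2 : (2 : R) ≠ 0) (h3 : IsEmpty (R ≃+* ZMod 3)) {n : ℕ} (hn : 0 < n) :
    IsTorsionClean (Nat.card R - 1) (Matrix (Fin n) (Fin n) R) := by
  let := hR.toField
  exact isTorsionClean_matrix h2 (four_le_card_of_not_ringEquiv h2 h3) hn

theorem theorem1p5 {R : Type*} [CommRing R] [IsDomain R] (hchar : ringChar R ≠ 2)
    (hF3 : IsEmpty (R ≃+* ZMod 3)) (q : ℕ) (hq : 1 < q) (hodd : Odd q) :
    ((∀ n : ℕ, 0 < n → IsTorsionClean (q - 1) (Matrix (Fin n) (Fin n) R)) ↔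
      (IsField R ∧ Finite R ∧ Nat.card R = q)) ∧
    ((∃ n : ℕ, 0 < n ∧ IsTorsionClean (q - 1) (Matrix (Fin n) (Fin n) R)) ↔
      (IsField R ∧ Finite R ∧ Nat.card R = q)) := by
  have h2 : (2 : R) ≠ 0 := Ring.two_ne_zero hchar
  have hsuff : IsField R ∧ Finite R ∧ Nat.card R = q →
      ∀ n : ℕ, 0 < n → IsTorsionClean (q - 1) (Matrix (Fin n) (Fin n) R) := by
    rintro ⟨hR, _, rfl⟩ n hn
    exact isTorsionClean_matrix_of_isField hR h2 hF3 hn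
  have hnec : ∀ n : ℕ, 0 < n → IsTorsionClean (q - 1) (Matrix (Fin n) (Fin n) R) →
      IsField R ∧ Finite R ∧ Nat.card R = q := by
    intro n hn h
    have hfin : Finite R := finite_of_forall_pow_eq_one_or h.1.1 fun r =>
      (h.1.2 (r • 1)).pow_eq_one_or_of_scalar hn
    have hR := Finite.isField_of_domain R
    refine ⟨hR, hfin, ?_⟩
    -- Sufficiency applied to `R` itself gives the least exponent as `|R| - 1`, which must equal `q
    -- - 1`.
    have := IsLeast.unique h (isTorsionClean_matrix_of_isField hR h2 hF3 hn)
    have : 0 < Nat.card R := Nat.card_pos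
    omega
  exact ⟨⟨fun h => hnec 1 one_pos (h 1 one_pos), hsuff⟩,
    ⟨fun ⟨n, hn, h⟩ => hnec n hn h, fun h => ⟨1, one_pos, hsuff h 1 one_pos⟩⟩⟩
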